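/- Let $\Omega$ be a finite non-empty set (the computational basis $\{|z\rangle\}$) and let $G$ be a group of permutations of $\Omega$ whose natural action is regular (transitive, and no non-identity element has a fixed point). For $\sigma\in G$ let $P_\sigma$ be the permutation matrix with $P_\sigma|x\rangle=|\sigma(x)\rangle$. Let $P_1,\dots,P_M$ be distinct non-identity elements of this representation, $D_0,D_1,\dots,D_M$ complex diagonal matrices, and assume that $$H=D_0+\sum_{j=1}^M D_jP_j$$ is Hermitian. For a diagonal matrix $D$ write $D(z)=\langle z|D|z\rangle$, and put $E_z=D_0(z)$. Let $\beta>0$, $\tau\in\mathbb R$, $\langle O\rangle=\mathrm{Tr}[Oe^{-\beta H}]/\mathrm{Tr}[e^{-\beta H}]$ and $A(\tau)=e^{\tau H}Ae^{-\tau H}$. For $t\in\mathbb R$ and a multiset $[x_0,\dots,x_q]$ let $$e^{t[x_0,\dots,x_q]}=\frac1{2\pi i}\oint_\Gamma\frac{e^{t\zeta}}{\prod_{i=0}^q(\zeta-x_i)}\,d\zeta$$ be the divided difference of $\zeta\mapsto e^{t\zeta}$, where $\Gamma$ is a positively oriented contour that encloses all the $x_i$. A configuration $\mathcal C=(z,\mathbf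 i_q)$ consists of $z\in\Omega$, an integer $q\ge 0$ and a sequence $(i_1,\dots,i_q)\in\{1,\dots,M\}^q$ with $P_{i_q}\cdots P_{i_1}=\mathbb 1$. Put $z_0=z$, $|z_p\rangle=P_{i_p}\cdots P_{i_1}|z\rangle$, and $$w_{\mathcal C}=\Big(\prod_{k=1}^qD_{i_k}(z_k)\Big)e^{-\beta[E_{z_0},\dots,E_{z_q}]}.$$ Let $\delta^{(p)}_{P_k}=1$ if $1\le p\le q$ and $P_{i_p}=P_k$, and $\delta^{(p)}_{P_k}=0$ otherwise. A function $O_{\mathcal C}$ of the configuration is called an (unbiased) estimator of $\langle O\rangle$, written $O_{\mathcal C}\mathrel{\widehat=}\langle O\rangle$, if $$\langle O\rangle=\frac{\sum_{\mathcal C}w_{\mathcal C}O_{\mathcal C}}{\sum_{\mathcal C}w_{\mathcal C}},$$ where both series over all configurations converge absolutely, and $\mathrm{Tr}[e^{-\beta H}]\ne0$ and $\sum_{\mathcal C}w_{\mathcal C}\neq0$. Then $e^{-\beta[E_{z_0},\dots,E_{z_q}]}\ne 0$ for every configuration, and the following hold. 1. For all complex diagonal matrices $\widetilde A,\widetilde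 B$, $$\widetilde A(z)\sum_{p=0}^{q}\widetilde B(z_p)\,\frac{e^{-\tau[E_{z_p},\dots,E_{z_q}]}\;e^{-(\beta-\tau)[E_{z_0},\dots,E_{z_p}]}}{e^{-\beta[E_{z_0},\dots,E_{z_q}]}}\;\mathrel{\widehat=}\;\langle\widetilde A(\tau)\widetilde B\rangle .$$ 2. For all $k,l\in\{1,\dots,M\}$ and all complex diagonal matrices $\widetilde A_k,\widetilde B_l$, with $A=\widetilde A_kD_kP_k$ and $B=\widetilde B_lD_lP_l$, $$\widetilde A_k(z)\,\delta^{(q)}_{P_k}\sum_{p=1}^{q-1}\delta^{(p)}_{P_l}\,\widetilde B_l(z_p)\,\frac{e^{-\tau[E_{z_p},\dots,E_{z_{q-1}}]}\;e^{-(\beta-\tau)[E_{z_0},\dots,E_{z_{p-1}}]}}{e^{-\beta[E_{z_0},\dots,E_{z_q}]}}\;\mathrel{\widehat=}\;\langle A(\tau)B\rangle ,$$ where the sum is empty, hence $0$, for $q\le1$. -/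

import Mathlib

open Matrix Equiv

noncomputable section

/-- The divided difference `f[x₀, …, x_q]` of a holomorphic function `f` over a multiset of nodes,
`(2πi)⁻¹ ∮ f(ζ) / ∏ᵢ (ζ - xᵢ) dζ`. The contour is a positively oriented circle about the origin
whose radius is larger than the modulus of every node, so it encloses all of them. -/
def dividedDifference (f : ℂ → ℂ) (x : Multiset ℂ) : ℂ :=
  (2 * (Real.pi : ℂ) * Complex.I)⁻¹ *
    ∮ ζ in C(0, 1 + (x.map fun a => ‖a‖).sum), f ζ / (x.map fun a => ζ - a).prod

/-- The divided difference of the exponential, `e^{t[x₀, …, x_q]}`, i.e. the divided difference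
of `ζ ↦ e^{tζ}`. -/
def expDD (t : ℝ) (x : Multiset ℂ) : ℂ :=
  dividedDifference (fun ζ => Complex.exp (t * ζ)) x

/-- The permutation matrix in the column convention: `P_σ |x⟩ = |σ x⟩`. -/
def permMat {Ω : Type*} [DecidableEq Ω] (σ : Perm Ω) : Matrix Ω Ω ℂ :=
  Matrix.of fun y x => if σ x = y then 1 else 0

/-- A permutation matrix representation `D₀ + ∑_{j = 1}^M D_j P_j` of a matrix on the
computational basis `Ω`. The `P_j` are distinct non-identity members of a permutation group `G`
whose natural action is regular (transitive and free). The term `D_j P_j`, `1 ≤ j ≤ M`, has the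
index `j - 1 : Fin M`, and a diagonal matrix is given by the function of its diagonal entries. -/
structure PMR (Ω : Type*) where
  /-- the group of the PMR basis -/
  G : Subgroup (Perm Ω)
  transitive : ∀ x y : Ω, ∃ σ ∈ G, σ x = y
  free : ∀ σ ∈ G, ∀ x : Ω, σ x = x → σ = 1
  /-- the number of off-diagonal terms -/
  M : ℕ
  /-- the permutations `P_j` of the off-diagonal terms -/
  perm : Fin M → Perm Ω
  perm_mem : ∀ j, perm j ∈ G
  perm_ne_one : ∀ j, perm j ≠ 1
  perm_injective : Function.Injective perm
  /-- the diagonal `D₀`, so that `E_z = energy z` -/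
  energy : Ω → ℂ
  /-- the diagonals `D_j` of the off-diagonal terms -/
  diag : Fin M → Ω → ℂ

namespace PMR

variable {Ω : Type*} [Fintype Ω] [DecidableEq Ω]

/-- The term `D_j P_j`. -/
def term (R : PMR Ω) (j : Fin R.M) : Matrix Ω Ω ℂ :=
  Matrix.diagonal (R.diag j) * permMat (R.perm j)

/-- The Hamiltonian `H = D₀ + ∑_j D_j P_j`. -/
def H (R : PMR Ω) : Matrix Ω Ω ℂ :=
  Matrix.diagonal R.energy + ∑ j, R.term j

/-- The thermal average `⟨O⟩ = Tr[O e^{-βH}] / Tr[e^{-βH}]`. -/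
def thermalAvg (R : PMR Ω) (β : ℝ) (O : Matrix Ω Ω ℂ) : ℂ :=
  (O * NormedSpace.exp (-(β : ℂ) • R.H)).trace / (NormedSpace.exp (-(β : ℂ) • R.H)).trace

/-- Imaginary-time evolution `O(τ) = e^{τH} O e^{-τH}`. -/
def evolve (R : PMR Ω) (τ : ℝ) (O : Matrix Ω Ω ℂ) : Matrix Ω Ω ℂ :=
  NormedSpace.exp ((τ : ℂ) • R.H) * O * NormedSpace.exp (-(τ : ℂ) • R.H)

/-- The product `P_{i_q} ⋯ P_{i_1}` for the word `[i_1, …, i_q]`. -/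
def wordPerm (R : PMR Ω) (w : List (Fin R.M)) : Perm Ω :=
  (w.map R.perm).reverse.prod

/-- A configuration: a basis state `z` and a word `[i_1, …, i_q]` of off-diagonal indices, of any
length `q`, with `P_{i_q} ⋯ P_{i_1} = 1`. -/
structure Config (R : PMR Ω) where
  z : Ω
  word : List (Fin R.M)
  closed : R.wordPerm word = 1

namespace Config

variable {R : PMR Ω}

/-- The expansion order `q`. -/
def q (c : R.Config) : ℕ := c.word.length

/-- `z_p = P_{i_p} ⋯ P_{i_1} z`. -/
def state (c : R.Config) (p : ℕ) : Ω := R.wordPerm (c.word.take p) c.z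

/-- The multiset `[E_{z_a}, …, E_{z_b}]`. -/
def energies (c : R.Config) (a b : ℕ) : Multiset ℂ :=
  (Finset.Icc a b).val.map fun p => R.energy (c.state p)

/-- The hopping strength `∏_{k = 1}^q D_{i_k}(z_k)`. -/
def hopping (c : R.Config) : ℂ :=
  ∏ k : Fin c.word.length, R.diag (c.word.get k) (c.state (k + 1))

/-- The generalized Boltzmann weight `w_C = ∏_k D_{i_k}(z_k) · e^{-β[E_{z_0}, …, E_{z_q}]}`. -/
def weight (c : R.Config) (β : ℝ) : ℂ :=
  c.hopping * expDD (-β) (c.energies 0 c.q)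

/-- `δ^{(p)}_{P_k}`: one if the `p`-th permutation (`1 ≤ p ≤ q`) of the word is `P_k`,
and zero otherwise. -/
def delta (c : R.Config) (p : ℕ) (k : Fin R.M) : ℂ :=
  if ∃ s : Fin c.word.length, (s : ℕ) + 1 = p ∧ R.perm (c.word.get s) = R.perm k then 1 else 0

/-- The estimator of `⟨A(τ) B⟩` for diagonal `A`, `B` with diagonals `a`, `b`. -/
def diagCorrelator (c : R.Config) (β τ : ℝ) (a b : Ω → ℂ) : ℂ :=
  a c.z * ∑ p ∈ Finset.Icc 0 c.q, b (c.state p) *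
    (expDD (-τ) (c.energies p c.q) * expDD (-(β - τ)) (c.energies 0 p) /
      expDD (-β) (c.energies 0 c.q))

/-- The estimator of `⟨A(τ) B⟩` for `A = Ã D_k P_k` and `B = B̃ D_l P_l`, where `Ã`, `B̃` are
diagonal with diagonals `a`, `b`. -/
def correlator (c : R.Config) (β τ : ℝ) (k l : Fin R.M) (a b : Ω → ℂ) : ℂ :=
  a c.z * c.delta c.q k * ∑ p ∈ Finset.Icc 1 (c.q - 1), c.delta p l * b (c.state p) *
    (expDD (-τ) (c.energies p (c.q - 1)) * expDD (-(β - τ)) (c.energies 0 (p - 1)) /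
      expDD (-β) (c.energies 0 c.q))

end Config

/-- `est` is an (unbiased) estimator of `⟨O⟩` at inverse temperature `β`:
`⟨O⟩ = (∑_C w_C est_C) / (∑_C w_C)`, where both series over all configurations converge
absolutely and neither the denominator nor the trace `Tr[e^{-βH}]` that defines `⟨O⟩` vanishes. -/
def IsEstimator (R : PMR Ω) (β : ℝ) (O : Matrix Ω Ω ℂ) (est : R.Config → ℂ) : Prop :=
  (NormedSpace.exp (-(β : ℂ) • R.H)).trace ≠ 0 ∧
  Summable (fun c : R.Config => c.weight β) ∧
  ∑' c : R.Config, c.weight β ≠ 0 ∧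
  Summable (fun c : R.Config => c.weight β * est c) ∧
  R.thermalAvg β O = (∑' c : R.Config, c.weight β * est c) / ∑' c : R.Config, c.weight β

end PMR

end

/-!
# Off-diagonal estimators in the permutation matrix representation

Expanding `e^{tH}` in the off-diagonal terms `D_j P_j` turns its matrix element `⟨y| e^{tH} |x⟩`
into a sum over words `[i_1, …, i_q]` whose permutations lead from `x` to `y`; the word contributes
`∏ D_{i_k}(z_k) · e^{t[E_{z_0}, …, E_{z_q}]}` (`PMR.hasSum_pathTerm`). Instead of expanding a
resolvent under the contour integral, the proof characterises `e^{tH}` by a differential equation.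
Divided differences satisfy `d/dt e^{t[x_0, …, x_q]} = x_0 e^{t[x_0, …, x_q]} + e^{t[x_1, …, x_q]}`
(`hasDerivAt_expDD_cons`), so that the matrix `K` of path sums, once the first step of every path is
split off, satisfies `K' = K H` with `K 0 = 1` (`PMR.pathSum_eq_exp`). All series converge
absolutely because the contour may be any large circle, on which each additional node gains a factor
that beats the number of words (`PMR.exists_summable_bound`).

By cyclicity, `Tr[A(τ) B e^{-βH}] = Tr[A e^{-τH} B e^{-(β-τ)H}]`. Expanding both exponentials
gives a sum over a state `z` and two paths (`PMR.hasSum_trace_split`). Their concatenation, with the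
steps of `A` and `B` inserted if these are not diagonal, is a closed path; since the group acts
freely, closed paths are exactly the configurations, and the two paths are recovered from the
configuration and the position `p` of the cut (`PMR.hasSum_config_of_hasSum_split`). The hopping
factor is multiplicative under concatenation, which leaves the ratio of divided differences in the
estimators.

Dividing by `e^{-β[E_{z_0}, …, E_{z_q}]}` is legitimate because `H` is Hermitian, hence the energies
are real, and a divided difference of `ζ ↦ e^{tζ}` over real nodes has the sign `(-1)^q` for `t < 0`
(`re_expDD_pos`). Finally `Tr[e^{-βH}] ≠ 0`, because `e^{-βH}` is the square of an invertible
Hermitian matrix.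
-/

open Matrix Equiv

/-! ### Divided differences as contour integrals -/

theorem differentiable_multiset_prod_sub (x : Multiset ℂ) :
    Differentiable ℂ fun ζ : ℂ => (x.map fun a => ζ - a).prod := by
  induction x using Multiset.induction with
  | empty => simp
  | cons a x ih =>
    simp only [Multiset.map_cons, Multiset.prod_cons]
    exact (differentiable_id.sub_const a).mul ih

theorem multiset_prod_sub_ne_zero {x : Multiset ℂ} {ζ : ℂ} {R : ℝ} (hx : ∀ a ∈ x, ‖a‖ < R)
    (hζ : R ≤ ‖ζ‖) : (x.map fun a => ζ - a).prod ≠ 0 := by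
  simp only [ne_eq, Multiset.prod_eq_zero_iff, Multiset.mem_map, not_exists, not_and]
  intro a ha h
  have := hx a ha
  rw [sub_eq_zero.1 h] at hζ
  linarith

theorem pow_card_le_norm_multiset_prod_sub {x : Multiset ℂ} {ζ : ℂ} {E R : ℝ} (hER : E ≤ R)
    (hx : ∀ a ∈ x, ‖a‖ ≤ E) (hζ : ‖ζ‖ = R) :
    (R - E) ^ x.card ≤ ‖(x.map fun a => ζ - a).prod‖ := by
  induction x using Multiset.induction with
  | empty => simp
  | cons a x ih =>
    simp only [Multiset.map_cons, Multiset.prod_cons, Multiset.card_cons, norm_mul, pow_succ']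
    have h1 := hx a (Multiset.mem_cons_self a x)
    have h2 := norm_sub_norm_le ζ a
    have h3 := ih fun b hb => hx b (Multiset.mem_cons_of_mem hb)
    have h4 : 0 ≤ R - E := by linarith
    gcongr
    linarith

theorem norm_lt_one_add_sum_norm {x : Multiset ℂ} {a : ℂ} (ha : a ∈ x) :
    ‖a‖ < 1 + (x.map fun a => ‖a‖).sum := by
  have : ‖a‖ ≤ (x.map fun a => ‖a‖).sum := by
    refine Multiset.single_le_sum ?_ _ (Multiset.mem_map_of_mem _ ha)
    intro b hb
    obtain ⟨c, -, rfl⟩ := Multiset.mem_map.1 hb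
    positivity
  linarith

theorem one_add_sum_norm_pos (x : Multiset ℂ) : 0 < 1 + (x.map fun a => ‖a‖).sum := by
  have : 0 ≤ (x.map fun a => ‖a‖).sum := by
    refine Multiset.sum_nonneg ?_
    intro b hb
    obtain ⟨c, -, rfl⟩ := Multiset.mem_map.1 hb
    positivity
  linarith

theorem circleIntegral_div_prod_eq_of_le {f : ℂ → ℂ} (hf : Differentiable ℂ f) {x : Multiset ℂ}
    {r R : ℝ} (hr : 0 < r) (hrR : r ≤ R) (hx : ∀ a ∈ x, ‖a‖ < r) :
    (∮ ζ in C(0, R), f ζ / (x.map fun a => ζ - a).prod) =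
      ∮ ζ in C(0, r), f ζ / (x.map fun a => ζ - a).prod := by
  have key : ∀ ζ : ℂ, r ≤ ‖ζ‖ →
      DifferentiableAt ℂ (fun ζ => f ζ / (x.map fun a => ζ - a).prod) ζ := fun ζ hζ =>
    (hf ζ).div (differentiable_multiset_prod_sub x ζ) (multiset_prod_sub_ne_zero hx hζ)
  refine Complex.circleIntegral_eq_of_differentiable_on_annulus_off_countable hr hrR
    Set.countable_empty ?_ ?_
  · intro ζ hζ
    refine (key ζ ?_).continuousAt.continuousWithinAt
    simpa using hζ.2
  · intro ζ hζ
    refine key ζ ?_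
    have : ¬ ‖ζ‖ ≤ r := by simpa using hζ.1.2
    linarith

/-- The contour of a divided difference of an entire function may be any circle about the origin
that encloses the nodes. -/
theorem dividedDifference_eq_circleIntegral {f : ℂ → ℂ} (hf : Differentiable ℂ f)
    {x : Multiset ℂ} {R : ℝ} (hR : 0 < R) (hx : ∀ a ∈ x, ‖a‖ < R) :
    dividedDifference f x = (2 * (Real.pi : ℂ) * Complex.I)⁻¹ *
      ∮ ζ in C(0, R), f ζ / (x.map fun a => ζ - a).prod := by
  unfold dividedDifference
  congr 1
  rcases le_total R (1 + (x.map fun a => ‖a‖).sum) with h | h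
  · exact circleIntegral_div_prod_eq_of_le hf hR h hx
  · exact (circleIntegral_div_prod_eq_of_le hf (one_add_sum_norm_pos x) h
      fun a ha => norm_lt_one_add_sum_norm ha).symm

theorem circleIntegrable_div_prod {f : ℂ → ℂ} (hf : Continuous f) {x : Multiset ℂ} {R : ℝ}
    (hR : 0 < R) (hx : ∀ a ∈ x, ‖a‖ < R) :
    CircleIntegrable (fun ζ => f ζ / (x.map fun a => ζ - a).prod) 0 R := by
  refine ContinuousOn.circleIntegrable hR.le ?_
  refine hf.continuousOn.div (differentiable_multiset_prod_sub x).continuous.continuousOn ?_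
  intro ζ hζ
  exact multiset_prod_sub_ne_zero hx (by simpa using hζ.ge)

theorem norm_dividedDifference_le {f : ℂ → ℂ} (hf : Differentiable ℂ f) {x : Multiset ℂ}
    {E R C : ℝ} (hE : 0 ≤ E) (hER : E < R) (hx : ∀ a ∈ x, ‖a‖ ≤ E)
    (hC : ∀ ζ : ℂ, ‖ζ‖ = R → ‖f ζ‖ ≤ C) :
    ‖dividedDifference f x‖ ≤ R * (C / (R - E) ^ x.card) := by
  have hR : 0 < R := by linarith
  rw [dividedDifference_eq_circleIntegral hf hR fun a ha => (hx a ha).trans_lt hER, ← smul_eq_mul]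
  refine circleIntegral.norm_two_pi_i_inv_smul_integral_le_of_norm_le_const hR.le ?_
  intro ζ hζ
  have hζ : ‖ζ‖ = R := by simpa using hζ
  have h0 : 0 < R - E := by linarith
  have h1 := pow_card_le_norm_multiset_prod_sub hER.le hx hζ
  have h2 := hC ζ hζ
  have h3 : 0 ≤ C := (norm_nonneg _).trans h2
  rw [norm_div]
  gcongr

theorem dividedDifference_zero {f : ℂ → ℂ} (hf : Differentiable ℂ f) :
    dividedDifference f 0 = 0 := by
  have h := (hf.diffContOnCl (s := Metric.ball 0 1)).circleIntegral_eq_zero zero_le_one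
  simp [dividedDifference, h]

theorem dividedDifference_singleton {f : ℂ → ℂ} (hf : Differentiable ℂ f) (a : ℂ) :
    dividedDifference f {a} = f a := by
  have hd := hf.diffContOnCl (s := Metric.ball 0 (1 + ‖a‖))
  have h := hd.two_pi_i_inv_smul_circleIntegral_sub_inv_smul (w := a) (by simp)
  simpa [dividedDifference, div_eq_inv_mul] using h

/-- A divided difference of the constant `1` over at least two nodes vanishes: its contour integral
is `O(R⁻¹)` when the radius `R` grows. -/
theorem dividedDifference_one {x : Multiset ℂ} (hx : 2 ≤ x.card) :
    dividedDifference (fun _ => 1) x = 0 := by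
  set E := 1 + (x.map fun a => ‖a‖).sum with hE
  have hE0 : 0 < E := one_add_sum_norm_pos x
  have key : ∀ R : ℝ, 2 * E + 1 ≤ R → ‖dividedDifference (fun _ => 1) x‖ ≤ 4 / R := by
    intro R hR
    have h := norm_dividedDifference_le (f := fun _ => 1) (C := 1) (by fun_prop) hE0.le
      (by linarith : E < R) (fun a ha => (norm_lt_one_add_sum_norm ha).le) (by simp)
    refine h.trans ?_
    have h1 : (R - E) ^ 2 ≤ (R - E) ^ x.card := pow_le_pow_right₀ (by linarith) hx
    have h2 : (R / 2) ^ 2 ≤ (R - E) ^ 2 := pow_le_pow_left₀ (by linarith) (by linarith) 2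
    have h3 : 0 < R := by linarith
    calc R * (1 / (R - E) ^ x.card) ≤ R * (1 / (R / 2) ^ 2) := by gcongr; exact h2.trans h1
      _ = 4 / R := by field_simp; norm_num
  have hlim : Filter.Tendsto (fun R : ℝ => 4 / R) Filter.atTop (nhds 0) :=
    Filter.Tendsto.const_div_atTop Filter.tendsto_id 4
  have := ge_of_tendsto hlim ((Filter.eventually_ge_atTop (2 * E + 1)).mono key)
  exact norm_le_zero_iff.1 this

/-- The recursion of divided differences. -/
theorem dividedDifference_mul_cons {f : ℂ → ℂ} (hf : Differentiable ℂ f) (a : ℂ)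
    (x : Multiset ℂ) :
    dividedDifference (fun ζ => ζ * f ζ) (a ::ₘ x) =
      a * dividedDifference f (a ::ₘ x) + dividedDifference f x := by
  set R := 1 + ((a ::ₘ x).map fun a => ‖a‖).sum
  have hR : 0 < R := one_add_sum_norm_pos _
  have hx : ∀ b ∈ a ::ₘ x, ‖b‖ < R := fun b hb => norm_lt_one_add_sum_norm hb
  have hx' : ∀ b ∈ x, ‖b‖ < R := fun b hb => hx b (Multiset.mem_cons_of_mem hb)
  rw [dividedDifference_eq_circleIntegral (by fun_prop) hR hx,
    dividedDifference_eq_circleIntegral hf hR hx, dividedDifference_eq_circleIntegral hf hR hx',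
    mul_left_comm, ← mul_add, ← circleIntegral.integral_const_mul a,
    ← circleIntegral.integral_add]
  · congr 1
    refine circleIntegral.integral_congr hR.le ?_
    intro ζ hζ
    have hζ : R ≤ ‖ζ‖ := by simpa using hζ.ge
    have h1 := multiset_prod_sub_ne_zero hx hζ
    have h2 := multiset_prod_sub_ne_zero hx' hζ
    simp only [Multiset.map_cons, Multiset.prod_cons] at h1 ⊢
    have h3 := left_ne_zero_of_mul h1
    field_simp
    ring
  · simpa [mul_div_assoc] using circleIntegrable_div_prod (f := fun ζ => a * f ζ)
      (hf.continuous.const_mul a) hR hx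
  · exact circleIntegrable_div_prod hf.continuous hR hx'

/-! ### Divided differences of the exponential -/

theorem differentiable_exp_mul (t : ℝ) : Differentiable ℂ fun ζ : ℂ => Complex.exp (t * ζ) := by
  fun_prop

theorem norm_exp_ofReal_mul_le {t T R : ℝ} (ht : |t| ≤ T) {ζ : ℂ} (hζ : ‖ζ‖ = R) :
    ‖Complex.exp (t * ζ)‖ ≤ Real.exp (T * R) := by
  refine (Complex.norm_exp_le_exp_norm _).trans (Real.exp_le_exp.2 ?_)
  rw [norm_mul, Complex.norm_real, Real.norm_eq_abs, hζ]
  exact mul_le_mul_of_nonneg_right ht (hζ ▸ norm_nonneg ζ)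

theorem expDD_singleton (t : ℝ) (a : ℂ) : expDD t {a} = Complex.exp (t * a) :=
  dividedDifference_singleton (differentiable_exp_mul t) a

theorem expDD_zero_of_two_le_card {x : Multiset ℂ} (hx : 2 ≤ x.card) : expDD 0 x = 0 := by
  simpa [expDD] using dividedDifference_one hx

theorem norm_expDD_le {t T E R : ℝ} (ht : |t| ≤ T) {x : Multiset ℂ} (hE : 0 ≤ E) (hER : E < R)
    (hx : ∀ a ∈ x, ‖a‖ ≤ E) :
    ‖expDD t x‖ ≤ R * (Real.exp (T * R) / (R - E) ^ x.card) :=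
  norm_dividedDifference_le (differentiable_exp_mul t) hE hER hx
    fun _ hζ => norm_exp_ofReal_mul_le ht hζ

theorem norm_dividedDifference_mul_exp_le {t T E R : ℝ} (ht : |t| ≤ T) {x : Multiset ℂ}
    (hE : 0 ≤ E) (hER : E < R) (hx : ∀ a ∈ x, ‖a‖ ≤ E) :
    ‖dividedDifference (fun ζ => ζ * Complex.exp (t * ζ)) x‖ ≤
      R * ((R * Real.exp (T * R)) / (R - E) ^ x.card) := by
  refine norm_dividedDifference_le (by fun_prop) hE hER hx fun ζ hζ => ?_
  rw [norm_mul, hζ]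
  exact mul_le_mul_of_nonneg_left (norm_exp_ofReal_mul_le ht hζ) (hE.trans hER.le)

theorem hasDerivAt_expDD (t : ℝ) (x : Multiset ℂ) :
    HasDerivAt (fun s : ℝ => expDD s x)
      (dividedDifference (fun ζ => ζ * Complex.exp (t * ζ)) x) t := by
  set R := 1 + (x.map fun a => ‖a‖).sum with hRdef
  have hR : 0 < R := one_add_sum_norm_pos _
  have hx : ∀ b ∈ x, ‖b‖ < R := fun b hb => norm_lt_one_add_sum_norm hb
  have hP : ∀ θ : ℝ, (x.map fun a => circleMap 0 R θ - a).prod ≠ 0 := fun θ =>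
    multiset_prod_sub_ne_zero hx (by simp [abs_of_pos hR])
  have hPc : Continuous fun θ : ℝ => (x.map fun a => circleMap 0 R θ - a).prod :=
    (differentiable_multiset_prod_sub x).continuous.comp (continuous_circleMap 0 R)
  have hc := continuous_circleMap 0 R
  refine HasDerivAt.const_mul _ ?_
  unfold circleIntegral
  simp only [deriv_circleMap, smul_eq_mul, ← hRdef]
  refine (intervalIntegral.hasDerivAt_integral_of_dominated_loc_of_deriv_le
    (F := fun (s : ℝ) (θ : ℝ) => circleMap 0 R θ * Complex.I *
      (Complex.exp (s * circleMap 0 R θ) / (x.map fun a => circleMap 0 R θ - a).prod))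
    (F' := fun (s : ℝ) (θ : ℝ) => circleMap 0 R θ * Complex.I *
      (circleMap 0 R θ * Complex.exp (s * circleMap 0 R θ) /
        (x.map fun a => circleMap 0 R θ - a).prod))
    (bound := fun θ => R * (R * Real.exp ((|t| + 1) * R) /
      ‖(x.map fun a => circleMap 0 R θ - a).prod‖))
    (Metric.ball_mem_nhds t one_pos) ?_ ?_ ?_ ?_ ?_ ?_).2
  · refine Filter.Eventually.of_forall fun s => Continuous.aestronglyMeasurable ?_
    exact (hc.mul continuous_const).mul
      ((Complex.continuous_exp.comp (continuous_const.mul hc)).div hPc hP)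
  · refine Continuous.intervalIntegrable ?_ _ _
    exact (hc.mul continuous_const).mul
      ((Complex.continuous_exp.comp (continuous_const.mul hc)).div hPc hP)
  · refine Continuous.aestronglyMeasurable ?_
    exact (hc.mul continuous_const).mul
      ((hc.mul (Complex.continuous_exp.comp (continuous_const.mul hc))).div hPc hP)
  · refine Filter.Eventually.of_forall fun θ _ s hs => ?_
    have hs : |s| ≤ |t| + 1 := by
      have h1 : |s - t| < 1 := by simpa [Real.dist_eq] using hs
      have h2 := abs_sub_abs_le_abs_sub s t
      linarith
    have h1 : ‖circleMap 0 R θ‖ = R := by simp [abs_of_pos hR]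
    have h2 := norm_exp_ofReal_mul_le hs h1
    simp only [norm_mul, norm_div, h1, Complex.norm_I, mul_one]
    gcongr
  · refine Continuous.intervalIntegrable ?_ _ _
    exact continuous_const.mul (continuous_const.div hPc.norm fun θ => norm_ne_zero_iff.2 (hP θ))
  · refine Filter.Eventually.of_forall fun θ _ s _ => ?_
    have h1 : HasDerivAt (fun s : ℝ => Complex.exp (s * circleMap 0 R θ))
        (Complex.exp (s * circleMap 0 R θ) * (1 * circleMap 0 R θ)) s :=
      ((Complex.ofRealCLM.hasDerivAt (x := s)).mul_const (circleMap 0 R θ)).cexp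
    convert! (h1.div_const _).const_mul _ using 2
    ring

theorem hasDerivAt_expDD_cons (t : ℝ) (a : ℂ) (x : Multiset ℂ) :
    HasDerivAt (fun s : ℝ => expDD s (a ::ₘ x)) (a * expDD t (a ::ₘ x) + expDD t x) t := by
  have h := hasDerivAt_expDD t (a ::ₘ x)
  rwa [dividedDifference_mul_cons (differentiable_exp_mul t)] at h

/-- For `t < 0` and real nodes `x₀, …, x_q`, the sign of `e^{t[x₀, …, x_q]}` is `(-1)^q`.
With `G t = e^{-t x₀} e^{t[x₀, …, x_q]}`, the derivative `G' t = e^{-t x₀} e^{t[x₁, …, x_q]}` has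
a constant sign by induction, and `G 0 = 0`. -/
theorem re_expDD_pos (x : Multiset ℝ) (a : ℝ) {t : ℝ} (ht : t < 0) :
    0 < (-1) ^ x.card * (expDD t ((a ::ₘ x).map (fun r : ℝ => (r : ℂ)))).re := by
  induction x using Multiset.induction generalizing a t with
  | empty =>
    have : Complex.exp (t * a) = (Real.exp (t * a) : ℝ) := by push_cast; rfl
    simp only [Multiset.cons_zero, Multiset.map_singleton, expDD_singleton, this,
      Complex.ofReal_re]
    simp [Real.exp_pos]
  | cons b x ih =>
    set y : Multiset ℂ := (b ::ₘ x).map (fun r : ℝ => (r : ℂ)) with hy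
    have hya : (a ::ₘ b ::ₘ x).map (fun r : ℝ => (r : ℂ)) = (a : ℂ) ::ₘ y := by
      rw [Multiset.map_cons]
    rw [hya]
    set G : ℝ → ℝ := fun s => Real.exp (-(s * a)) *
      ((-1) ^ (b ::ₘ x).card * (expDD s ((a : ℂ) ::ₘ y)).re) with hG
    have hderiv : ∀ s, HasDerivAt G
        (-(Real.exp (-(s * a)) * ((-1) ^ x.card * (expDD s y).re))) s := by
      intro s
      have h1 : HasDerivAt (fun s : ℝ => Real.exp (-(s * a)))
          (Real.exp (-(s * a)) * (-(1 * a))) s :=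
        (((hasDerivAt_id s).mul_const a).neg).exp
      have h2 := (Complex.reCLM.hasFDerivAt.comp_hasDerivAt s
        (hasDerivAt_expDD_cons s (a : ℂ) y)).const_mul ((-1 : ℝ) ^ (b ::ₘ x).card)
      have h3 := h1.mul h2
      convert! h3 using 1
      simp [pow_succ]
      ring
    have hanti : StrictAntiOn G (Set.Iic 0) := by
      refine strictAntiOn_of_deriv_neg (convex_Iic 0)
        (fun s _ => (hderiv s).continuousAt.continuousWithinAt) ?_
      intro s hs
      rw [interior_Iic] at hs
      rw [(hderiv s).deriv, neg_lt_zero]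
      exact mul_pos (Real.exp_pos _) (ih b hs)
    have h0 : G 0 = 0 := by
      simp [hG, expDD_zero_of_two_le_card (x := (a : ℂ) ::ₘ y) (by simp [hy])]
    have h := hanti ht.le (Set.mem_Iic.2 le_rfl) ht
    rw [h0] at h
    exact pos_of_mul_pos_right h (Real.exp_pos _).le

theorem expDD_ne_zero_of_real {x : Multiset ℂ} (hx : x ≠ 0) (hreal : ∀ a ∈ x, a.im = 0) {t : ℝ}
    (ht : t < 0) : expDD t x ≠ 0 := by
  have hmap : (x.map Complex.re).map (fun r : ℝ => (r : ℂ)) = x := by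
    rw [Multiset.map_map]
    conv_rhs => rw [← Multiset.map_id x]
    refine Multiset.map_congr rfl fun a ha => ?_
    apply Complex.ext <;> simp [hreal a ha]
  obtain ⟨a, ha⟩ := Multiset.exists_mem_of_ne_zero hx
  obtain ⟨y, hy⟩ := Multiset.exists_cons_of_mem (Multiset.mem_map_of_mem Complex.re ha)
  have h := re_expDD_pos y a.re ht
  rw [← hy, hmap] at h
  intro h0
  simp [h0] at h

/-! ### Auxiliary facts on series and on permutation matrices -/

theorem HasSum.prod_of_fintype {ι κ : Type*} [Fintype ι] {f : ι × κ → ℂ} {s : ι → ℂ}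
    (h : ∀ i, HasSum (fun k => f (i, k)) (s i)) : HasSum f (∑ i, s i) := by
  classical
  have key : ∀ i, HasSum (fun p : ι × κ => if p.1 = i then f p else 0) (s i) := by
    intro i
    refine ((Prod.mk_right_injective i).hasSum_iff ?_).1 (by simpa [Function.comp_def] using h i)
    rintro ⟨i', k⟩ hk
    refine if_neg ?_
    rintro rfl
    exact hk ⟨k, rfl⟩
  have h2 := hasSum_sum (s := Finset.univ) fun i _ => key i
  refine h2.congr_fun ?_
  intro p
  simp

theorem summable_pow_length {m : ℕ} {r : ℝ} (hr : 0 ≤ r) (hmr : m * r < 1) :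
    Summable fun w : List (Fin m) => r ^ w.length := by
  rw [← (Equiv.sigmaFiberEquiv (List.length (α := Fin m))).summable_iff]
  -- The fibre over `n` is the type of vectors of length `n`.
  have : ∀ n : ℕ, Fintype {w : List (Fin m) // w.length = n} := fun n =>
    inferInstanceAs (Fintype (List.Vector (Fin m) n))
  have hcard : ∀ n : ℕ, Fintype.card {w : List (Fin m) // w.length = n} = m ^ n := fun n => by
    have h := card_vector (α := Fin m) n
    rw [Fintype.card_fin] at h
    rw [← h]
    exact Fintype.card_congr (Equiv.refl _)
  refine (summable_sigma_of_nonneg fun _ => by simpa using pow_nonneg hr _).2 ⟨?_, ?_⟩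
  · intro n
    exact Summable.of_finite
  · have : ∀ n : ℕ, (∑' w : {w : List (Fin m) // w.length = n}, r ^ (w : List (Fin m)).length) =
        (m * r) ^ n := by
      intro n
      rw [tsum_fintype, Finset.sum_congr rfl fun w _ => by rw [w.2]]
      rw [Finset.sum_const, Finset.card_univ, hcard, mul_pow]
      simp
    exact (summable_geometric_of_lt_one (by positivity) hmr).congr fun n => (this n).symm

theorem permMat_one {Ω : Type*} [DecidableEq Ω] : permMat (1 : Perm Ω) = 1 := by
  ext y x
  simp [permMat, Matrix.one_apply, eq_comm]

theorem mul_diagonal_mul_permMat_apply {Ω : Type*} [Fintype Ω] [DecidableEq Ω]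
    (N : Matrix Ω Ω ℂ) (d : Ω → ℂ) (σ : Perm Ω) (y x : Ω) :
    (N * (diagonal d * permMat σ)) y x = N y (σ x) * d (σ x) := by
  rw [← Matrix.mul_assoc, Matrix.mul_apply]
  simp [permMat, Matrix.mul_diagonal]

theorem diagonal_mul_permMat_mul_apply {Ω : Type*} [Fintype Ω] [DecidableEq Ω]
    (N : Matrix Ω Ω ℂ) (d : Ω → ℂ) (σ : Perm Ω) (y x : Ω) :
    (diagonal d * permMat σ * N) y x = d y * N (σ⁻¹ y) x := by
  rw [Matrix.mul_assoc, Matrix.diagonal_mul, Matrix.mul_apply]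
  simp [permMat, ← Perm.eq_inv_iff_eq]

/-! ### The path expansion of the matrix exponential -/

namespace PMR

variable {Ω : Type*}

theorem wordPerm_nil (R : PMR Ω) : R.wordPerm [] = 1 := rfl

theorem wordPerm_cons (R : PMR Ω) (j : Fin R.M) (w : List (Fin R.M)) :
    R.wordPerm (j :: w) = R.wordPerm w * R.perm j := by
  simp [wordPerm]

theorem wordPerm_append (R : PMR Ω) (u v : List (Fin R.M)) :
    R.wordPerm (u ++ v) = R.wordPerm v * R.wordPerm u := by
  simp [wordPerm]

theorem wordPerm_mem (R : PMR Ω) (w : List (Fin R.M)) : R.wordPerm w ∈ R.G := by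
  induction w with
  | nil => exact R.G.one_mem
  | cons j w ih => rw [wordPerm_cons]; exact R.G.mul_mem ih (R.perm_mem j)

theorem wordPerm_eq_one_iff (R : PMR Ω) (w : List (Fin R.M)) (z : Ω) :
    R.wordPerm w = 1 ↔ R.wordPerm w z = z :=
  ⟨fun h => by simp [h], R.free _ (R.wordPerm_mem w) z⟩

/-- The energies of the states that the path with steps `w` visits when it starts at `z`, both
endpoints included. -/
def nodes (R : PMR Ω) : Ω → List (Fin R.M) → Multiset ℂ
  | z, [] => {R.energy z}
  | z, j :: w => R.energy z ::ₘ R.nodes (R.perm j z) w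

/-- The product of the off-diagonal matrix elements along the path with steps `w` that starts
at `z`. -/
def hop (R : PMR Ω) : Ω → List (Fin R.M) → ℂ
  | _, [] => 1
  | z, j :: w => R.diag j (R.perm j z) * R.hop (R.perm j z) w

theorem card_nodes (R : PMR Ω) (z : Ω) (w : List (Fin R.M)) :
    (R.nodes z w).card = w.length + 1 := by
  induction w generalizing z with
  | nil => simp [nodes]
  | cons j w ih => simp [nodes, ih]

theorem nodes_ne_zero (R : PMR Ω) (z : Ω) (w : List (Fin R.M)) : R.nodes z w ≠ 0 := by
  rw [← Multiset.card_pos, card_nodes]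
  omega

theorem exists_energy_eq_of_mem_nodes (R : PMR Ω) {z : Ω} {w : List (Fin R.M)} {a : ℂ}
    (ha : a ∈ R.nodes z w) : ∃ y, R.energy y = a := by
  induction w generalizing z with
  | nil => exact ⟨z, by simpa [nodes, eq_comm] using ha⟩
  | cons j w ih =>
    rcases Multiset.mem_cons.1 ha with rfl | h
    · exact ⟨z, rfl⟩
    · exact ih h

theorem hop_append (R : PMR Ω) (z : Ω) (u v : List (Fin R.M)) :
    R.hop z (u ++ v) = R.hop z u * R.hop (R.wordPerm u z) v := by
  induction u generalizing z with
  | nil => simp [hop, wordPerm_nil]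
  | cons j u ih => simp [hop, ih, wordPerm_cons, mul_assoc]

theorem norm_le_of_mem_nodes [Fintype Ω] (R : PMR Ω) {z : Ω} {w : List (Fin R.M)} {a : ℂ}
    (ha : a ∈ R.nodes z w) : ‖a‖ ≤ ∑ z, ‖R.energy z‖ := by
  obtain ⟨y, rfl⟩ := R.exists_energy_eq_of_mem_nodes ha
  exact Finset.single_le_sum (f := fun z => ‖R.energy z‖) (fun _ _ => norm_nonneg _)
    (Finset.mem_univ y)

theorem norm_hop_le [Fintype Ω] (R : PMR Ω) (z : Ω) (w : List (Fin R.M)) :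
    ‖R.hop z w‖ ≤ (∑ j, ∑ z, ‖R.diag j z‖) ^ w.length := by
  induction w generalizing z with
  | nil => simp [hop]
  | cons j w ih =>
    simp only [hop, norm_mul, List.length_cons, pow_succ']
    refine mul_le_mul ?_ (ih _) (norm_nonneg _)
      (Finset.sum_nonneg fun _ _ => Finset.sum_nonneg fun _ _ => norm_nonneg _)
    exact (Finset.single_le_sum (f := fun z => ‖R.diag j z‖) (fun _ _ => norm_nonneg _)
      (Finset.mem_univ _)).trans (Finset.single_le_sum (f := fun j => ∑ z, ‖R.diag j z‖)
        (fun _ _ => Finset.sum_nonneg fun _ _ => norm_nonneg _) (Finset.mem_univ j))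

variable [DecidableEq Ω]

/-- The contribution of the path with steps `w` to the matrix element `⟨y| e^{tH} |x⟩`. It is zero
unless the path leads from `x` to `y`. -/
noncomputable def pathTerm (R : PMR Ω) (t : ℝ) (x y : Ω) (w : List (Fin R.M)) : ℂ :=
  if R.wordPerm w x = y then R.hop x w * expDD t (R.nodes x w) else 0

/-- The derivative of `pathTerm` with respect to `t`. -/
noncomputable def pathTermDeriv (R : PMR Ω) (t : ℝ) (x y : Ω) (w : List (Fin R.M)) : ℂ :=
  if R.wordPerm w x = y then
    R.hop x w * dividedDifference (fun ζ => ζ * Complex.exp (t * ζ)) (R.nodes x w) else 0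

theorem hasDerivAt_pathTerm (R : PMR Ω) (t : ℝ) (x y : Ω) (w : List (Fin R.M)) :
    HasDerivAt (fun s : ℝ => R.pathTerm s x y w) (R.pathTermDeriv t x y w) t := by
  unfold pathTerm pathTermDeriv
  split_ifs
  · exact (hasDerivAt_expDD t _).const_mul _
  · exact hasDerivAt_const t _

/-- What remains of `pathTermDeriv` when the energy of the initial state is split off: the paths
with their first step removed. -/
noncomputable def firstStep (R : PMR Ω) (t : ℝ) (x y : Ω) : List (Fin R.M) → ℂ
  | [] => 0
  | j :: w => R.diag j (R.perm j x) * R.pathTerm t (R.perm j x) y w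

theorem pathTermDeriv_eq (R : PMR Ω) (t : ℝ) (x y : Ω) (w : List (Fin R.M)) :
    R.pathTermDeriv t x y w = R.energy x * R.pathTerm t x y w + R.firstStep t x y w := by
  unfold pathTermDeriv pathTerm
  have h0 := dividedDifference_mul_cons (differentiable_exp_mul t) (R.energy x)
  cases w with
  | nil =>
    have h := h0 0
    simp only [Multiset.cons_zero, dividedDifference_zero (differentiable_exp_mul t)] at h
    simp only [nodes, h, firstStep, hop]
    split_ifs <;> simp [expDD]
  | cons j w =>
    simp only [nodes, h0, firstStep, hop, pathTerm, wordPerm_cons, Perm.mul_apply]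
    split_ifs
    · simp only [expDD]; ring
    · simp

theorem pathTerm_zero (R : PMR Ω) (x y : Ω) (w : List (Fin R.M)) (hw : w ≠ []) :
    R.pathTerm 0 x y w = 0 := by
  have : 2 ≤ (R.nodes x w).card := by
    have := List.length_pos_iff.2 hw
    rw [card_nodes]
    omega
  simp [pathTerm, expDD_zero_of_two_le_card this]

variable [Fintype Ω]

/-- A summable majorant of all paths, uniform in `|t| ≤ T`: on a circle of large radius, the
factor that each step gains from the divided difference beats the number of possible steps. -/
theorem exists_summable_bound (R : PMR Ω) (T : ℝ) :
    ∃ u : List (Fin R.M) → ℝ, Summable u ∧ ∀ t : ℝ, |t| ≤ T → ∀ x y w,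
      ‖R.pathTerm t x y w‖ ≤ u w ∧ ‖R.pathTermDeriv t x y w‖ ≤ u w := by
  set E := ∑ z, ‖R.energy z‖
  set D := ∑ j, ∑ z, ‖R.diag j z‖
  have hE : 0 ≤ E := Finset.sum_nonneg fun _ _ => norm_nonneg _
  have hD : 0 ≤ D := Finset.sum_nonneg fun _ _ => Finset.sum_nonneg fun _ _ => norm_nonneg _
  -- With radius `ρ = E + S`, a path of length `q` is `O((D / S) ^ q)`. There are `M ^ q` words of
  -- length `q`, and `M * (D / S) < 1`.
  set S := 1 + R.M * D with hS
  have hMD : 0 ≤ R.M * D := by positivity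
  have hS0 : 0 < S := by linarith
  set ρ := E + S with hρ
  have hρE : ρ - E = S := by ring
  have hρ1 : 1 ≤ ρ := by linarith
  set C := ρ * (ρ * Real.exp (T * ρ)) / S with hC
  have hu : ∀ w : List (Fin R.M), D ^ w.length *
      (ρ * (ρ * Real.exp (T * ρ) / (ρ - E) ^ (w.length + 1))) = C * (D / S) ^ w.length := by
    intro w
    rw [hρE, hC, div_pow, pow_succ]
    field_simp
  refine ⟨fun w => C * (D / S) ^ w.length, ?_, ?_⟩
  · refine (summable_pow_length (by positivity) ?_).mul_left C
    rw [← mul_div_assoc, div_lt_one hS0]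
    linarith
  · intro t ht x y w
    have hE' : E < ρ := by linarith
    have hx : ∀ a ∈ R.nodes x w, ‖a‖ ≤ E := fun a ha => R.norm_le_of_mem_nodes ha
    have hhop := R.norm_hop_le x w
    have hC0 : 0 ≤ C * (D / S) ^ w.length := by positivity
    constructor
    · unfold pathTerm
      split_ifs
      · refine le_of_le_of_eq ?_ (hu w)
        rw [norm_mul]
        refine mul_le_mul hhop ?_ (norm_nonneg _) (by positivity)
        refine (norm_expDD_le ht hE hE' hx).trans ?_
        rw [card_nodes, hρE]
        have : Real.exp (T * ρ) ≤ ρ * Real.exp (T * ρ) :=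
          le_mul_of_one_le_left (Real.exp_pos _).le hρ1
        gcongr
      · simpa using hC0
    · unfold pathTermDeriv
      split_ifs
      · refine le_of_le_of_eq ?_ (hu w)
        rw [norm_mul]
        refine mul_le_mul hhop ?_ (norm_nonneg _) (by positivity)
        simpa only [card_nodes] using norm_dividedDifference_mul_exp_le ht hE hE' hx
      · simpa using hC0

theorem summable_norm_pathTerm (R : PMR Ω) (t : ℝ) (x y : Ω) :
    Summable fun w => ‖R.pathTerm t x y w‖ := by
  obtain ⟨u, hu, h⟩ := R.exists_summable_bound |t|
  exact Summable.of_nonneg_of_le (fun _ => norm_nonneg _) (fun w => (h t le_rfl x y w).1) hu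

theorem summable_pathTerm (R : PMR Ω) (t : ℝ) (x y : Ω) : Summable (R.pathTerm t x y) :=
  (R.summable_norm_pathTerm t x y).of_norm

/-- The matrix of path sums, whose entry at `(y, x)` is the sum over all paths from `x` to `y`. -/
noncomputable def pathSum (R : PMR Ω) (t : ℝ) : Matrix Ω Ω ℂ :=
  Matrix.of fun y x => ∑' w, R.pathTerm t x y w

theorem hasSum_pathSum (R : PMR Ω) (t : ℝ) (x y : Ω) :
    HasSum (R.pathTerm t x y) (R.pathSum t y x) :=
  (R.summable_pathTerm t x y).hasSum

theorem hasSum_firstStep (R : PMR Ω) (t : ℝ) (x y : Ω) :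
    HasSum (R.firstStep t x y)
      (∑ j, R.diag j (R.perm j x) * R.pathSum t y (R.perm j x)) := by
  have hinj : Function.Injective fun p : Fin R.M × List (Fin R.M) => p.1 :: p.2 := by
    rintro ⟨i, u⟩ ⟨j, v⟩ h
    simpa using h
  refine (hinj.hasSum_iff ?_).1 ?_
  · rintro (_ | ⟨j, w⟩) h
    · rfl
    · exact absurd ⟨(j, w), rfl⟩ h
  · exact HasSum.prod_of_fintype fun j => (R.hasSum_pathSum t (R.perm j x) y).mul_left _

theorem pathSum_mul_H_apply (R : PMR Ω) (t : ℝ) (y x : Ω) :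
    (R.pathSum t * R.H) y x = R.energy x * R.pathSum t y x +
      ∑ j, R.diag j (R.perm j x) * R.pathSum t y (R.perm j x) := by
  simp only [H, term, Matrix.mul_add, Matrix.mul_sum, Matrix.add_apply, Matrix.sum_apply,
    mul_diagonal_mul_permMat_apply, Matrix.mul_diagonal]
  simp only [mul_comm]

theorem hasDerivAt_pathSum_apply (R : PMR Ω) (t : ℝ) (y x : Ω) :
    HasDerivAt (fun s => R.pathSum s y x) ((R.pathSum t * R.H) y x) t := by
  obtain ⟨u, hu, h⟩ := R.exists_summable_bound (|t| + 1)
  have hball : ∀ s ∈ Metric.ball (0 : ℝ) (|t| + 1), |s| ≤ |t| + 1 := fun s hs => by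
    simpa using (Metric.mem_ball.1 hs).le
  have ht : t ∈ Metric.ball (0 : ℝ) (|t| + 1) := by simp
  have key := hasDerivAt_tsum_of_isPreconnected (g := fun w s => R.pathTerm s x y w)
    (g' := fun w s => R.pathTermDeriv s x y w) hu Metric.isOpen_ball
    (convex_ball (0 : ℝ) (|t| + 1)).isPreconnected
    (fun w s _ => R.hasDerivAt_pathTerm s x y w) (fun w s hs => (h s (hball s hs) x y w).2)
    ht (R.summable_pathTerm t x y) ht
  have hsum : HasSum (R.pathTermDeriv t x y) ((R.pathSum t * R.H) y x) := by
    rw [pathSum_mul_H_apply]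
    exact (((R.hasSum_pathSum t x y).mul_left _).add (R.hasSum_firstStep t x y)).congr_fun
      fun w => R.pathTermDeriv_eq t x y w
  rw [hsum.tsum_eq] at key
  exact key

theorem pathSum_zero (R : PMR Ω) : R.pathSum 0 = 1 := by
  ext y x
  have h : HasSum (R.pathTerm 0 x y) (R.pathTerm 0 x y []) :=
    hasSum_single [] fun w hw => R.pathTerm_zero x y w hw
  rw [(R.hasSum_pathSum 0 x y).unique h]
  simp [pathTerm, hop, nodes, wordPerm_nil, expDD_singleton, Matrix.one_apply, eq_comm]

open scoped Matrix.Norms.Operator in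
/-- Both sides solve `K' = K H` with `K 0 = 1`. -/
theorem pathSum_eq_exp (R : PMR Ω) (t : ℝ) :
    R.pathSum t = NormedSpace.exp ((t : ℂ) • R.H) := by
  have hK : ∀ s, HasDerivAt R.pathSum (R.pathSum s * R.H) s := fun s =>
    hasDerivAt_pi.2 fun y => hasDerivAt_pi.2 fun x => R.hasDerivAt_pathSum_apply s y x
  have hexp : ∀ s : ℝ, HasDerivAt (fun s : ℝ => NormedSpace.exp (s • -R.H))
      (-R.H * NormedSpace.exp (s • -R.H)) s := fun s => hasDerivAt_exp_smul_const' (-R.H) s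
  have hconst : ∀ s, R.pathSum s * NormedSpace.exp (s • -R.H) = 1 := by
    intro s
    have hd : ∀ s, HasDerivAt (fun s => R.pathSum s * NormedSpace.exp (s • -R.H)) 0 s := by
      intro s
      convert! (hK s).mul (hexp s) using 1
      simp [Matrix.mul_assoc]
    have h := is_const_of_deriv_eq_zero (fun s => (hd s).differentiableAt)
      (fun s => (hd s).deriv) s 0
    simpa [pathSum_zero] using h
  have h1 : NormedSpace.exp (t • -R.H) * NormedSpace.exp ((t : ℂ) • R.H) = 1 := by
    rw [← Matrix.exp_add_of_commute]
    · simp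
    · simp
  calc R.pathSum t = R.pathSum t * (NormedSpace.exp (t • -R.H) *
        NormedSpace.exp ((t : ℂ) • R.H)) := by rw [h1, Matrix.mul_one]
    _ = NormedSpace.exp ((t : ℂ) • R.H) := by rw [← Matrix.mul_assoc, hconst, Matrix.one_mul]

/-- The expansion of the matrix exponential as a sum over paths:
`⟨y| e^{tH} |x⟩ = ∑ D_{i_q}(z_q) ⋯ D_{i_1}(z_1) e^{t[E_{z_0}, …, E_{z_q}]}`, over all words
`[i_1, …, i_q]` that lead from `x` to `y`. -/
theorem hasSum_pathTerm (R : PMR Ω) (t : ℝ) (x y : Ω) :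
    HasSum (R.pathTerm t x y) (NormedSpace.exp ((t : ℂ) • R.H) y x) :=
  R.pathSum_eq_exp t ▸ R.hasSum_pathSum t x y

end PMR

/-! ### Configurations as closed paths -/

namespace PMR

variable {Ω : Type*}

theorem nodes_eq_map_range (R : PMR Ω) (z : Ω) (w : List (Fin R.M)) :
    R.nodes z w =
      (Multiset.range (w.length + 1)).map fun p => R.energy (R.wordPerm (w.take p) z) := by
  induction w generalizing z with
  | nil => simp [nodes, wordPerm_nil]
  | cons j w ih =>
    have h : Multiset.range (w.length + 1 + 1) =
        0 ::ₘ (Multiset.range (w.length + 1)).map Nat.succ := by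
      simp only [← Multiset.coe_range, List.range_succ_eq_map, Multiset.map_coe,
        Multiset.cons_coe]
    rw [List.length_cons, h, Multiset.map_cons, Multiset.map_map, nodes, ih]
    simp [wordPerm_nil, wordPerm_cons]

theorem hop_eq_prod (R : PMR Ω) (z : Ω) (w : List (Fin R.M)) :
    R.hop z w =
      ∏ k : Fin w.length, R.diag (w.get k) (R.wordPerm (w.take (k + 1)) z) := by
  induction w generalizing z with
  | nil => simp [hop]
  | cons j w ih =>
    rw [hop, ih]
    simp only [List.length_cons, Fin.prod_univ_succ]
    simp [wordPerm_cons, wordPerm_nil]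

namespace Config

variable {R : PMR Ω}

theorem ext {c d : R.Config} (hz : c.z = d.z) (hw : c.word = d.word) : c = d := by
  cases c; cases d
  subst hz
  subst hw
  rfl

theorem hopping_eq (c : R.Config) : c.hopping = R.hop c.z c.word :=
  (R.hop_eq_prod c.z c.word).symm

theorem energies_eq_nodes (c : R.Config) {u v w : List (Fin R.M)} (h : c.word = u ++ (v ++ w)) :
    c.energies u.length (u.length + v.length) = R.nodes (R.wordPerm u c.z) v := by
  have hIcc : (Finset.Icc u.length (u.length + v.length)).val =
      (Multiset.range (v.length + 1)).map (u.length + ·) := by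
    have h1 := Finset.map_add_left_Icc 0 v.length u.length
    rw [add_zero] at h1
    rw [← h1, Finset.map_val, ← Nat.range_succ_eq_Icc_zero, Finset.range_val]
    rfl
  rw [energies, hIcc, Multiset.map_map, nodes_eq_map_range]
  refine Multiset.map_congr rfl fun p hp => ?_
  have hp : p ≤ v.length := Nat.lt_succ_iff.1 (Multiset.mem_range.1 hp)
  simp only [Function.comp_apply, state, h, List.take_length_add_append,
    List.take_append_of_le_length hp, wordPerm_append, Perm.mul_apply]

theorem energies_eq_nodes_word (c : R.Config) : c.energies 0 c.q = R.nodes c.z c.word := by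
  have h := c.energies_eq_nodes (u := []) (v := c.word) (w := []) (by simp)
  simpa [wordPerm_nil, q] using h

theorem weight_mul_div (c : R.Config) {β : ℝ} (h : expDD (-β) (c.energies 0 c.q) ≠ 0) (s : ℂ) :
    c.weight β * (s / expDD (-β) (c.energies 0 c.q)) = R.hop c.z c.word * s := by
  rw [weight, hopping_eq]
  field_simp

theorem delta_of_eq [Fintype Ω] [DecidableEq Ω] (c : R.Config) {u v : List (Fin R.M)} {j : Fin R.M}
    (h : c.word = u ++ j :: v) : c.delta (u.length + 1) j = 1 := by
  refine if_pos ⟨⟨u.length, by simp [h]⟩, rfl, ?_⟩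
  congr 1
  simp [h]

theorem exists_eq_of_delta_ne_zero [Fintype Ω] [DecidableEq Ω] (c : R.Config) {p : ℕ}
    {j : Fin R.M} (h : c.delta p j ≠ 0) : ∃ u v, c.word = u ++ j :: v ∧ u.length + 1 = p := by
  unfold delta at h
  split_ifs at h with h1
  · obtain ⟨s, hs, hj⟩ := h1
    have hj : c.word[(s : ℕ)] = j := R.perm_injective hj
    refine ⟨c.word.take s, c.word.drop (s + 1), ?_, ?_⟩
    · rw [← hj, List.cons_getElem_drop_succ, List.take_append_drop]
    · rw [List.length_take, min_eq_left s.2.le, hs]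
  · exact absurd rfl h

end Config

/-- Regrouping of a sum over an initial state and two words into a sum over configurations, each
with a finite sum over positions `p`. The map `m` sends the two words to the word that they form
and to the position of the cut. -/
theorem hasSum_config_of_hasSum_split {R : PMR Ω}
    {m : List (Fin R.M) × List (Fin R.M) → List (Fin R.M) × ℕ} (hm : Function.Injective m)
    {F : Ω × (List (Fin R.M) × List (Fin R.M)) → ℂ} {S : ℂ} (hF : HasSum F S)
    {s : R.Config → Finset ℕ} {g : R.Config → ℕ → ℂ}
    (hopen : ∀ z uv, R.wordPerm (m uv).1 ≠ 1 → F (z, uv) = 0)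
    (hclosed : ∀ (c : R.Config) uv, c.word = (m uv).1 →
      (m uv).2 ∈ s c ∧ g c (m uv).2 = F (c.z, uv))
    (hrange : ∀ (c : R.Config) p, p ∈ s c → g c p ≠ 0 → ∃ uv, m uv = (c.word, p)) :
    HasSum (fun c => ∑ p ∈ s c, g c p) S := by
  classical
  have hsub : HasSum (fun x : {x : Ω × (List (Fin R.M) × List (Fin R.M)) //
      R.wordPerm (m x.2).1 = 1} => F x) S := by
    refine (hasSum_subtype_iff_of_support_subset
      (s := {x : Ω × (List (Fin R.M) × List (Fin R.M)) | R.wordPerm (m x.2).1 = 1}) ?_).2 hF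
    intro x hx
    by_contra h
    exact hx (hopen x.1 x.2 h)
  set G : R.Config × ℕ → ℂ := fun x => if x.2 ∈ s x.1 then g x.1 x.2 else 0 with hG
  set i : {x : Ω × (List (Fin R.M) × List (Fin R.M)) // R.wordPerm (m x.2).1 = 1} →
      R.Config × ℕ := fun x => (⟨x.1.1, (m x.1.2).1, x.2⟩, (m x.1.2).2) with hi
  have hinj : Function.Injective i := by
    rintro ⟨⟨z, uv⟩, h⟩ ⟨⟨z', uv'⟩, h'⟩ hx
    simp only [hi, Prod.mk.injEq, Config.mk.injEq] at hx
    obtain ⟨⟨hz, hw⟩, hp⟩ := hx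
    have := hm (Prod.ext hw hp)
    subst hz
    subst this
    rfl
  have hGS : HasSum G S := by
    refine (hinj.hasSum_iff ?_).1 (hsub.congr_fun ?_)
    · rintro ⟨c, p⟩ hx
      by_contra h
      simp only [hG, ite_eq_right_iff, Classical.not_imp] at h
      obtain ⟨uv, huv⟩ := hrange c p h.1 h.2
      refine hx ⟨⟨(c.z, uv), ?_⟩, ?_⟩
      · rw [huv]; exact c.closed
      · simp only [hi, huv]
    · rintro ⟨⟨z, uv⟩, h⟩
      have h2 := hclosed ⟨z, (m uv).1, h⟩ uv rfl
      simp only [Function.comp_apply, hi, hG, if_pos h2.1, h2.2]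
  refine hGS.prod_fiberwise fun c => ?_
  have hsum : ∑ p ∈ s c, G (c, p) = ∑ p ∈ s c, g c p :=
    Finset.sum_congr rfl fun p hp => if_pos hp
  rw [← hsum]
  exact hasSum_sum_of_ne_finset_zero fun p hp => if_neg hp

/-! ### Traces as sums over closed paths -/

variable [Fintype Ω] [DecidableEq Ω]

theorem hasSum_weight (R : PMR Ω) (β : ℝ) :
    HasSum (fun c : R.Config => c.weight β) (NormedSpace.exp (-(β : ℂ) • R.H)).trace := by
  have h : HasSum (fun p : Ω × List (Fin R.M) => R.pathTerm (-β) p.1 p.1 p.2)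
      (NormedSpace.exp (-(β : ℂ) • R.H)).trace := by
    have h1 := HasSum.prod_of_fintype (f := fun p : Ω × List (Fin R.M) =>
      R.pathTerm (-β) p.1 p.1 p.2) fun z => R.hasSum_pathTerm (-β) z z
    simpa [Matrix.trace] using h1
  have hinj : Function.Injective fun c : R.Config => (c.z, c.word) := by
    intro c d hcd
    simp only [Prod.mk.injEq] at hcd
    exact Config.ext hcd.1 hcd.2
  refine ((hinj.hasSum_iff ?_).2 h).congr_fun ?_
  · rintro ⟨z, w⟩ hzw
    refine if_neg fun hw => hzw ?_
    exact ⟨⟨z, w, (R.wordPerm_eq_one_iff w z).2 hw⟩, rfl⟩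
  · intro c
    simp [pathTerm, Config.weight, c.hopping_eq, c.energies_eq_nodes_word, c.closed]

/-- The trace `Tr[A e^{sH} B e^{s'H}]` with `A = α P_σ` and `B = γ P_ρ`, as a sum over an initial
state `z`, a path `u` from `z` and a path `v` from `ρ (u z)` to `σ⁻¹ z`. -/
theorem hasSum_trace_split (R : PMR Ω) (s s' : ℝ) (α γ : Ω → ℂ) (σ ρ : Perm Ω) :
    HasSum (fun p : Ω × (List (Fin R.M) × List (Fin R.M)) =>
        α p.1 * γ (ρ (R.wordPerm p.2.1 p.1)) *
          R.pathTerm s (ρ (R.wordPerm p.2.1 p.1)) (σ⁻¹ p.1) p.2.2 *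
          (R.hop p.1 p.2.1 * expDD s' (R.nodes p.1 p.2.1)))
      (diagonal α * permMat σ * NormedSpace.exp ((s : ℂ) • R.H) * (diagonal γ * permMat ρ) *
        NormedSpace.exp ((s' : ℂ) • R.H)).trace := by
  have htrace : (diagonal α * permMat σ * NormedSpace.exp ((s : ℂ) • R.H) *
      (diagonal γ * permMat ρ) * NormedSpace.exp ((s' : ℂ) • R.H)).trace =
      ∑ z, ∑ y, α z * γ (ρ y) * (NormedSpace.exp ((s' : ℂ) • R.H) y z *
        NormedSpace.exp ((s : ℂ) • R.H) (σ⁻¹ z) (ρ y)) := by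
    rw [Matrix.trace]
    refine Finset.sum_congr rfl fun z _ => ?_
    rw [Matrix.diag_apply, Matrix.mul_apply]
    refine Finset.sum_congr rfl fun y _ => ?_
    rw [mul_diagonal_mul_permMat_apply, diagonal_mul_permMat_mul_apply]
    ring
  rw [htrace]
  refine HasSum.prod_of_fintype fun z => ?_
  have h : ∀ y, HasSum (fun p : List (Fin R.M) × List (Fin R.M) => α z * γ (ρ y) *
      (R.pathTerm s' z y p.1 * R.pathTerm s (ρ y) (σ⁻¹ z) p.2))
      (α z * γ (ρ y) * (NormedSpace.exp ((s' : ℂ) • R.H) y z *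
        NormedSpace.exp ((s : ℂ) • R.H) (σ⁻¹ z) (ρ y))) := fun y =>
    ((R.hasSum_pathTerm s' z y).mul (R.hasSum_pathTerm s (ρ y) (σ⁻¹ z))
      (summable_mul_of_summable_norm (R.summable_norm_pathTerm s' z y)
        (R.summable_norm_pathTerm s (ρ y) (σ⁻¹ z)))).mul_left _
  refine (hasSum_sum fun y _ => h y).congr_fun ?_
  rintro ⟨u, v⟩
  rw [Finset.sum_eq_single (R.wordPerm u z)]
  · simp only [pathTerm, if_true]
    ring
  · intro y _ hy
    simp [pathTerm, hy.symm]
  · simp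

/-- Cyclicity of the trace and `e^{-βH} e^{τH} = e^{-(β-τ)H}`. -/
theorem trace_evolve_mul (R : PMR Ω) (β τ : ℝ) (A B : Matrix Ω Ω ℂ) :
    (R.evolve τ A * B * NormedSpace.exp (-(β : ℂ) • R.H)).trace =
      (A * NormedSpace.exp (((-τ : ℝ) : ℂ) • R.H) * B *
        NormedSpace.exp (((-(β - τ) : ℝ) : ℂ) • R.H)).trace := by
  have h : NormedSpace.exp (((-(β - τ) : ℝ) : ℂ) • R.H) =
      NormedSpace.exp (-(β : ℂ) • R.H) * NormedSpace.exp ((τ : ℂ) • R.H) := by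
    rw [← Matrix.exp_add_of_commute _ _
      (((Commute.refl R.H).smul_left _).smul_right _), ← add_smul]
    congr 2
    push_cast
    ring
  rw [h, evolve]
  simp only [Matrix.mul_assoc, Complex.ofReal_neg]
  rw [Matrix.trace_mul_comm]
  simp only [Matrix.mul_assoc]

/-! ### Hermitian Hamiltonians -/

theorem H_apply_self (R : PMR Ω) (z : Ω) : R.H z z = R.energy z := by
  have h : ∀ j, R.term j z z = 0 := by
    intro j
    have : R.perm j z ≠ z := fun h => R.perm_ne_one j (R.free _ (R.perm_mem j) z h)
    simp [term, permMat, Matrix.diagonal_mul, this]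
  simp [H, Matrix.sum_apply, h]

theorem energy_im_eq_zero (R : PMR Ω) (hH : R.H.IsHermitian) (z : Ω) : (R.energy z).im = 0 := by
  have h := hH.apply z z
  rw [H_apply_self] at h
  exact Complex.conj_eq_iff_im.1 h

theorem expDD_energies_ne_zero {R : PMR Ω} (hH : R.H.IsHermitian) {β : ℝ} (hβ : 0 < β)
    (c : R.Config) : expDD (-β) (c.energies 0 c.q) ≠ 0 := by
  rw [c.energies_eq_nodes_word]
  refine expDD_ne_zero_of_real (R.nodes_ne_zero _ _) ?_ (neg_lt_zero.2 hβ)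
  intro a ha
  obtain ⟨y, rfl⟩ := R.exists_energy_eq_of_mem_nodes ha
  exact R.energy_im_eq_zero hH y

open scoped ComplexOrder in
/-- With `S = e^{-βH/2}` Hermitian and invertible, `Tr[e^{-βH}] = Tr[S† S] ≠ 0`. -/
theorem trace_exp_ne_zero [Nonempty Ω] {R : PMR Ω} (hH : R.H.IsHermitian) (β : ℝ) :
    (NormedSpace.exp (-(β : ℂ) • R.H)).trace ≠ 0 := by
  set S := NormedSpace.exp (((-(β / 2) : ℝ) : ℂ) • R.H) with hS
  have hS1 : Sᴴ = S := by
    refine Matrix.IsHermitian.exp ?_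
    rw [Matrix.IsHermitian, Matrix.conjTranspose_smul, hH.eq]
    congr 1
    exact Complex.conj_ofReal _
  have hS2 : NormedSpace.exp (-(β : ℂ) • R.H) = Sᴴ * S := by
    rw [hS1, hS, ← Matrix.exp_add_of_commute _ _ (Commute.refl _), ← add_smul]
    congr 2
    push_cast
    ring
  rw [hS2]
  intro h
  have h0 := Matrix.trace_conjTranspose_mul_self_eq_zero_iff.1 h
  exact (Matrix.isUnit_exp (((-(β / 2) : ℝ) : ℂ) • R.H)).ne_zero h0

/-! ### The estimators -/

theorem isEstimator_of_hasSum [Nonempty Ω] {R : PMR Ω} (hH : R.H.IsHermitian) {β : ℝ}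
    {O : Matrix Ω Ω ℂ} {est : R.Config → ℂ}
    (h : HasSum (fun c : R.Config => c.weight β * est c)
      (O * NormedSpace.exp (-(β : ℂ) • R.H)).trace) : R.IsEstimator β O est := by
  have hw := R.hasSum_weight β
  refine ⟨trace_exp_ne_zero hH β, hw.summable, ?_, h.summable, ?_⟩
  · rw [hw.tsum_eq]
    exact trace_exp_ne_zero hH β
  · rw [thermalAvg, h.tsum_eq, hw.tsum_eq]

theorem hasSum_weight_mul_diagCorrelator {R : PMR Ω} {β : ℝ}
    (hne : ∀ c : R.Config, expDD (-β) (c.energies 0 c.q) ≠ 0) (τ : ℝ) (a b : Ω → ℂ) :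
    HasSum (fun c : R.Config => c.weight β * c.diagCorrelator β τ a b)
      (R.evolve τ (diagonal a) * diagonal b * NormedSpace.exp (-(β : ℂ) • R.H)).trace := by
  have hF := R.hasSum_trace_split (-τ) (-(β - τ)) a b 1 1
  simp only [permMat_one, Matrix.mul_one, Perm.one_apply, inv_one] at hF
  rw [trace_evolve_mul]
  have hm : Function.Injective fun uv : List (Fin R.M) × List (Fin R.M) =>
      (uv.1 ++ uv.2, uv.1.length) := by
    rintro ⟨u, v⟩ ⟨u', v'⟩ h
    simp only [Prod.mk.injEq] at h
    obtain ⟨h1, h2⟩ := List.append_inj h.1 h.2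
    rw [h1, h2]
  refine (hasSum_config_of_hasSum_split hm hF (s := fun c => Finset.Icc 0 c.q)
    (g := fun c p => R.hop c.z c.word * (a c.z * (b (c.state p) *
      (expDD (-τ) (c.energies p c.q) * expDD (-(β - τ)) (c.energies 0 p))))) ?_ ?_ ?_).congr_fun ?_
  · rintro z ⟨u, v⟩ h
    have : R.wordPerm v (R.wordPerm u z) ≠ z := fun h' => h
      ((R.wordPerm_eq_one_iff _ z).2 (by simpa [wordPerm_append] using h'))
    simp [pathTerm, this]
  · rintro c ⟨u, v⟩ h
    simp only at h ⊢
    have hq : c.q = u.length + v.length := by simp [Config.q, h]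
    have hcl : R.wordPerm v (R.wordPerm u c.z) = c.z := by
      rw [← Perm.mul_apply, ← wordPerm_append, ← h, c.closed, Perm.one_apply]
    have hst : c.state u.length = R.wordPerm u c.z := by simp [Config.state, h]
    have he1 : c.energies u.length c.q = R.nodes (R.wordPerm u c.z) v := by
      rw [hq]
      exact c.energies_eq_nodes (w := []) (by simpa using h)
    have he2 : c.energies 0 u.length = R.nodes c.z u := by
      simpa [wordPerm_nil] using c.energies_eq_nodes (u := []) (v := u) (w := v) (by simpa using h)
    refine ⟨by simp [hq], ?_⟩
    rw [hst, he1, he2, h, hop_append, pathTerm, if_pos hcl]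
    ring
  · intro c p hp _
    refine ⟨(c.word.take p, c.word.drop p), ?_⟩
    have : p ≤ c.word.length := (Finset.mem_Icc.1 hp).2
    simp [this]
  · intro c
    rw [Config.diagCorrelator, Finset.mul_sum, Finset.mul_sum]
    refine Finset.sum_congr rfl fun p _ => ?_
    rw [← c.weight_mul_div (hne c)]
    ring

theorem diagonal_mul_term (R : PMR Ω) (a : Ω → ℂ) (k : Fin R.M) :
    diagonal a * R.term k = diagonal (fun z => a z * R.diag k z) * permMat (R.perm k) := by
  rw [term, ← Matrix.mul_assoc, Matrix.diagonal_mul_diagonal]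

theorem hasSum_weight_mul_correlator {R : PMR Ω} {β : ℝ}
    (hne : ∀ c : R.Config, expDD (-β) (c.energies 0 c.q) ≠ 0) (τ : ℝ) (k l : Fin R.M)
    (a b : Ω → ℂ) :
    HasSum (fun c : R.Config => c.weight β * c.correlator β τ k l a b)
      (R.evolve τ (diagonal a * R.term k) * (diagonal b * R.term l) *
        NormedSpace.exp (-(β : ℂ) • R.H)).trace := by
  have hF := R.hasSum_trace_split (-τ) (-(β - τ)) (fun z => a z * R.diag k z)
    (fun z => b z * R.diag l z) (R.perm k) (R.perm l)
  rw [trace_evolve_mul, diagonal_mul_term, diagonal_mul_term]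
  -- The operators `B` and `A` are the steps `l` and `k` of the word, and `k` is its last step.
  have hm : Function.Injective fun uv : List (Fin R.M) × List (Fin R.M) =>
      (uv.1 ++ l :: (uv.2 ++ [k]), uv.1.length + 1) := by
    rintro ⟨u, v⟩ ⟨u', v'⟩ h
    simp only [Prod.mk.injEq, add_left_inj] at h
    obtain ⟨h1, h2⟩ := List.append_inj h.1 h.2
    rw [h1, List.append_cancel_right (List.cons_injective h2)]
  have hword : ∀ (z : Ω) (u v : List (Fin R.M)), R.wordPerm (u ++ l :: (v ++ [k])) z =
      R.perm k (R.wordPerm v (R.perm l (R.wordPerm u z))) := by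
    intro z u v
    simp [wordPerm_append, wordPerm_cons, wordPerm_nil]
  refine (hasSum_config_of_hasSum_split hm hF (s := fun c => Finset.Icc 1 (c.q - 1))
    (g := fun c p => R.hop c.z c.word * (a c.z * c.delta c.q k * (c.delta p l * b (c.state p) *
      (expDD (-τ) (c.energies p (c.q - 1)) * expDD (-(β - τ)) (c.energies 0 (p - 1))))))
      ?_ ?_ ?_).congr_fun ?_
  · rintro z ⟨u, v⟩ h
    have : R.wordPerm v (R.perm l (R.wordPerm u z)) ≠ (R.perm k)⁻¹ z := by
      intro h'
      refine h ((R.wordPerm_eq_one_iff _ z).2 ?_)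
      rw [hword]
      exact Perm.eq_inv_iff_eq.1 h'
    simp only [pathTerm, if_neg this, mul_zero, zero_mul]
  · rintro c ⟨u, v⟩ h
    simp only at h ⊢
    have hq : c.q = u.length + 1 + v.length + 1 := by
      simp [Config.q, h]
      omega
    have hcl : R.perm k (R.wordPerm v (R.perm l (R.wordPerm u c.z))) = c.z := by
      rw [← hword, ← h, c.closed, Perm.one_apply]
    have hcl' : R.wordPerm v (R.perm l (R.wordPerm u c.z)) = (R.perm k)⁻¹ c.z :=
      Perm.eq_inv_iff_eq.2 hcl
    have hst : c.state (u.length + 1) = R.perm l (R.wordPerm u c.z) := by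
      simp [Config.state, h, List.take_length_add_append, wordPerm_append, wordPerm_cons,
        wordPerm_nil]
    have hsplit : c.word = (u ++ [l]) ++ (v ++ [k]) := by simp [h]
    have he1 : c.energies (u.length + 1) (c.q - 1) =
        R.nodes (R.perm l (R.wordPerm u c.z)) v := by
      have he := c.energies_eq_nodes hsplit
      rw [hq]
      simpa [wordPerm_append, wordPerm_cons, wordPerm_nil] using he
    have he2 : c.energies 0 (u.length + 1 - 1) = R.nodes c.z u := by
      simpa [wordPerm_nil] using
        c.energies_eq_nodes (u := []) (v := u) (w := l :: (v ++ [k])) (by simpa using h)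
    have hd1 : c.delta (u.length + 1) l = 1 := c.delta_of_eq h
    have hd2 : c.delta c.q k = 1 := by
      have := c.delta_of_eq (u := u ++ l :: v) (v := []) (j := k) (by simp [h])
      rw [hq, ← this]
      congr 1
      simp
      omega
    refine ⟨by simp [hq], ?_⟩
    rw [hst, he1, he2, hd1, hd2, h, hop_append, pathTerm, if_pos hcl', hop, hop_append, hop, hop,
      hcl]
    ring
  · intro c p hp hg
    obtain ⟨hp1, hpq⟩ := Finset.mem_Icc.1 hp
    have hdk : c.delta c.q k ≠ 0 := fun h => hg (by simp [h])
    have hdl : c.delta p l ≠ 0 := fun h => hg (by simp [h])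
    obtain ⟨u', v', h1, h2⟩ := c.exists_eq_of_delta_ne_zero hdk
    obtain ⟨u, v, h3, h4⟩ := c.exists_eq_of_delta_ne_zero hdl
    have hv' : v' = [] := by
      have : c.q = u'.length + 1 + v'.length := by
        simp [Config.q, h1]
        omega
      exact List.length_eq_zero_iff.1 (by omega)
    -- The step at `p ≤ q - 1` is not the last one, so a nonempty word ending in `k` follows it.
    rcases List.eq_nil_or_concat v with rfl | ⟨v₀, x, rfl⟩
    · have : c.q = u.length + 1 := by simp [Config.q, h3]
      omega
    · have hx : x = k := by
        have h5 : (u ++ l :: v₀) ++ [x] = u' ++ [k] := by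
          rw [hv'] at h1
          rw [← h1, h3]
          simp
        simpa using (List.append_inj' h5 rfl).2
      refine ⟨(u, v₀), ?_⟩
      rw [h3, ← h4, hx]
      simp
  · intro c
    rw [Config.correlator, Finset.mul_sum, Finset.mul_sum]
    refine Finset.sum_congr rfl fun p _ => ?_
    rw [← c.weight_mul_div (hne c)]
    ring

end PMR

theorem mainTheorem4 {Ω : Type*} [Fintype Ω] [DecidableEq Ω] [Nonempty Ω] (R : PMR Ω)
    (hH : R.H.IsHermitian) (β : ℝ) (hβ : 0 < β) (τ : ℝ) :
    (∀ c : R.Config, expDD (-β) (c.energies 0 c.q) ≠ 0) ∧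
    (∀ a b : Ω → ℂ,
      R.IsEstimator β (R.evolve τ (Matrix.diagonal a) * Matrix.diagonal b)
        (fun c => c.diagCorrelator β τ a b)) ∧
    (∀ (k l : Fin R.M) (a b : Ω → ℂ),
      R.IsEstimator β
        (R.evolve τ (Matrix.diagonal a * R.term k) * (Matrix.diagonal b * R.term l))
        (fun c => c.correlator β τ k l a b)) := by
  have hne := fun c : R.Config => PMR.expDD_energies_ne_zero hH hβ c
  exact ⟨hne,
    fun a b => PMR.isEstimator_of_hasSum hH (PMR.hasSum_weight_mul_diagCorrelator hne τ a b),
    fun k l a b => PMR.isEstimator_of_hasSum hH (PMR.hasSum_weight_mul_correlator hne τ k l a b)⟩
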